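/- Let $N\ge 2$, let $\Omega\subset\mathbb R^N$ be open and bounded, and let $A\subset\Omega$ be a finite set. Let $f\in C(\overline\Omega)\cap C^1(\Omega\setminus A)$ be real-valued and suppose that, for some $\alpha\in(0,1)$, $\limsup_{x\to c}\frac{|f(x)-f(c)|}{|x-c|^{\alpha}}<\infty$ for every $c\in A$, and that $f\in W^{1,p}(\Omega)$ for some $p\in(N,\infty]$. Let $\nabla f$ be the classical gradient of $f$ on $\Omega\setminus A$ (it agrees almost everywhere on $\Omega$ with the weak gradient), let $\omega_N=2\pi^{N/2}/\Gamma(N/2)$ be the area of the unit sphere of $\mathbb R^N$, $B_R(a)=\{x\in\mathbb R^N:|x-a|<R\}$, let $\sigma$ be the surface measure on $\partial B_R(a)$, and let $\frac{1}{|B_R(a)|}\int_{B_R(a)}$ and $\frac{1}{|\partial B_R(a)|}\int_{\partial B_R(a)}$ denote the means with respect to Lebesgue measure and to $\sigma$. Then, for all $a\in\Omega$ and $R>0$ with $B_R(a)\subset\Omega$, all the integrals below converge absolutely, and for every $y\in B_R(a)$ $$\begin{aligned} f(y)={}&\frac{1}{|B_R(a)|}\int_{B_R(a)}f\,dx-\frac{1}{|\partial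 B_R(a)|}\int_{\partial B_R(a)}f\,d\sigma+\int_{\partial B_R(a)}\frac{f(x)\,\langle x-y,x-a\rangle}{R\,\omega_N|x-y|^N}\,d\sigma(x)\\ &-\frac1{\omega_N}\int_{B_R(a)}\left(\frac{\langle\nabla f(x),x-y\rangle}{|x-y|^N}-\frac{\langle\nabla f(x),x-a\rangle}{R^N}\right)dx.\end{aligned}$$ In particular, $$f(a)=\frac{1}{|B_R(a)|}\int_{B_R(a)}f\,dx-\frac1{\omega_N}\int_{B_R(a)}\left(\frac1{|x-a|^N}-\frac1{R^N}\right)\langle\nabla f(x),x-a\rangle\,dx$$ and $$f(a)=\frac{1}{|\partial B_R(a)|}\int_{\partial B_R(a)}f\,d\sigma-\frac1{\omega_N}\int_{B_R(a)}\frac{\langle\nabla f(x),x-a\rangle}{|x-a|^N}\,dx.$$ -/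

import Mathlib

open MeasureTheory Set Metric Filter Topology
open scoped ENNReal ContDiff

/-- Surface measure on the sphere `∂B_R(a)` of radius `R` about `a` in `ℝ^N`, as a measure on
`ℝ^N`: the surface measure of the unit sphere is transported by `ω ↦ a + R ω` and multiplied
by `R ^ (N - 1)`. -/
noncomputable def sphereMeasure {N : ℕ} (a : EuclideanSpace ℝ (Fin N)) (R : ℝ) :
    Measure (EuclideanSpace ℝ (Fin N)) :=
  ENNReal.ofReal (R ^ (N - 1)) •
    Measure.map (fun w : sphere (0 : EuclideanSpace ℝ (Fin N)) 1 =>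
      a + R • (w : EuclideanSpace ℝ (Fin N)))
      (volume : Measure (EuclideanSpace ℝ (Fin N))).toSphere

/-- The area `ω_N` of the unit sphere in `ℝ^N`. -/
noncomputable def sphereArea (N : ℕ) : ℝ :=
  (volume : Measure (EuclideanSpace ℝ (Fin N))).toSphere.real univ

/-- `ω_N = 2 π ^ (N / 2) / Γ (N / 2)`. -/
theorem sphereArea_eq {N : ℕ} (hN : N ≠ 0) :
    sphereArea N = 2 * Real.pi ^ ((N : ℝ) / 2) / Real.Gamma ((N : ℝ) / 2) := by
  have : Nonempty (Fin N) := ⟨⟨0, Nat.pos_of_ne_zero hN⟩⟩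
  have hN' : (0 : ℝ) < N := by exact_mod_cast Nat.pos_of_ne_zero hN
  have hG : 0 < Real.Gamma ((N : ℝ) / 2) := Real.Gamma_pos_of_pos (by positivity)
  have hpi : Real.sqrt Real.pi ^ N = Real.pi ^ ((N : ℝ) / 2) := by
    rw [Real.sqrt_eq_rpow, ← Real.rpow_natCast, ← Real.rpow_mul Real.pi_pos.le]
    congr 1
    ring
  have hG1 : 0 < Real.Gamma ((N : ℝ) / 2 + 1) := Real.Gamma_pos_of_pos (by positivity)
  rw [sphereArea, Measure.toSphere_real_apply_univ, measureReal_def,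
    EuclideanSpace.volume_ball]
  simp only [finrank_euclideanSpace, Fintype.card_fin, ENNReal.ofReal_one, one_pow, one_mul, hpi]
  rw [ENNReal.toReal_ofReal (by positivity), Real.Gamma_add_one (by positivity)]
  field_simp

/-- The Sobolev space `W^{1,p}(Ω)`: `u ∈ L^p(Ω)` and, for every coordinate `i`, there is
`g i ∈ L^p(Ω)` which is the weak partial derivative of `u` in direction `i` on `Ω`. -/
def MemSobolevOne {N : ℕ} (p : ℝ≥0∞) (Ω : Set (EuclideanSpace ℝ (Fin N)))
    (u : EuclideanSpace ℝ (Fin N) → ℝ) : Prop :=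
  MemLp u p (volume.restrict Ω) ∧
    ∃ g : Fin N → EuclideanSpace ℝ (Fin N) → ℝ, ∀ i,
      MemLp (g i) p (volume.restrict Ω) ∧
      ∀ φ : EuclideanSpace ℝ (Fin N) → ℝ,
        ContDiff ℝ ∞ φ → HasCompactSupport φ → tsupport φ ⊆ Ω →
        ∫ x in Ω, u x * fderiv ℝ φ x (EuclideanSpace.single i 1) = -∫ x in Ω, g i x * φ x

/-! Put `e = (a - y) / R`, so `‖e‖ < 1`, and sweep `B_R(a)` by the segments `s ↦ y + s • (w + e)`,
`0 < s < R`, `‖w‖ = 1`, which run from `y` to the boundary point `a + R • w`. In these skew polar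
coordinates Lebesgue measure is `s ^ (N - 1) * (1 + ⟨w, e⟩) ds dw` (`skew_polar_ball`). The powers
of `s` cancel against the kernel `⟨∇f, x - y⟩ / |x - y|^N`, leaving the derivative of `f` along the
segment times `k(w) = (1 + ⟨w, e⟩) / ‖w + e‖^N`. Integrating along segments gives `∫ k(w) (f(a + R
w) - f(y)) dw`, and `k` has total mass `ω_N` (`integral_one_add_inner_div_norm_pow`). This is `f(y)`
as a sphere integral minus a gradient integral (`representation_by_sphere_kernel`).

A second identity, from the radial derivative of `s ^ N * f(a + s w)`, expresses the ball mean minus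
the sphere mean by `∫ ⟨∇f, x - a⟩` (`average_ball_sub_average_sphere`). The stated formulas are
combinations of these two.

The hypothesis `p > N` enters through Hölder: `|x - y|^(1 - N)` lies in the conjugate `L^q` on
balls, so the singular integral converges. Fubini then makes the derivative integrable on almost
every segment, and the fundamental theorem of calculus tolerates the countably many parameters where
the segment meets `A`. -/

/-! ### Polar coordinates for integrable functions -/

section PolarCoordinates

variable {E : Type*} [NormedAddCommGroup E] [NormedSpace ℝ E] [FiniteDimensional ℝ E]
  [MeasurableSpace E] [BorelSpace E] [Nontrivial E] (μ : Measure E) [μ.IsAddHaarMeasure]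

theorem integrable_polar_iff {h : E → ℝ} :
    Integrable (fun p : sphere (0 : E) 1 × Ioi (0 : ℝ) => h ((p.2 : ℝ) • (p.1 : E)))
      (μ.toSphere.prod (Measure.volumeIoiPow (Module.finrank ℝ E - 1))) ↔ Integrable h μ := by
  have key := μ.measurePreserving_homeomorphUnitSphereProd.integrable_comp_emb
    (g := fun p : sphere (0 : E) 1 × Ioi (0 : ℝ) => h ((p.2 : ℝ) • (p.1 : E)))
    (Homeomorph.measurableEmbedding _)
  have hr : Integrable h μ ↔ IntegrableOn h {(0 : E)}ᶜ μ := by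
    rw [IntegrableOn, restrict_compl_singleton]
  rw [← key, hr, integrableOn_iff_comap_subtypeVal (measurableSet_singleton (0 : E)).compl]
  refine integrable_congr (.of_forall fun x => ?_)
  have hx : ‖(x : E)‖ ≠ 0 := norm_ne_zero_iff.2 x.2
  simp [smul_smul, hx]

theorem integral_polar_prod (h : E → ℝ) :
    ∫ p : sphere (0 : E) 1 × Ioi (0 : ℝ), h ((p.2 : ℝ) • (p.1 : E))
      ∂(μ.toSphere.prod (Measure.volumeIoiPow (Module.finrank ℝ E - 1))) = ∫ x, h x ∂μ := by
  have hr : ∫ x, h x ∂μ = ∫ x in {(0 : E)}ᶜ, h x ∂μ := by rw [restrict_compl_singleton]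
  rw [← μ.measurePreserving_homeomorphUnitSphereProd.integral_comp
    (Homeomorph.measurableEmbedding _), hr,
    ← integral_subtype_comap (measurableSet_singleton (0 : E)).compl]
  refine integral_congr_ae (.of_forall fun x => ?_)
  have hx : ‖(x : E)‖ ≠ 0 := norm_ne_zero_iff.2 x.2
  simp [smul_smul, hx]

theorem integrable_volumeIoiPow_iff {n : ℕ} {g : ℝ → ℝ} :
    Integrable (fun s : Ioi (0 : ℝ) => g s) (Measure.volumeIoiPow n) ↔
      IntegrableOn (fun s => s ^ n * g s) (Ioi 0) := by
  rw [integrableOn_iff_comap_subtypeVal measurableSet_Ioi, Measure.volumeIoiPow,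
    integrable_withDensity_iff_integrable_smul' (by fun_prop) (by simp)]
  refine integrable_congr (.of_forall ?_)
  rintro ⟨x, hx : 0 < x⟩
  simp (disch := positivity) [ENNReal.toReal_ofReal]

theorem integral_volumeIoiPow {n : ℕ} (g : ℝ → ℝ) :
    ∫ s : Ioi (0 : ℝ), g s ∂(Measure.volumeIoiPow n) = ∫ s in Ioi 0, s ^ n * g s := by
  simp only [Measure.volumeIoiPow, ENNReal.ofReal]
  rw [integral_withDensity_eq_integral_smul,
    integral_subtype_comap measurableSet_Ioi fun a ↦ Real.toNNReal (a ^ n) • g a,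
    setIntegral_congr_fun measurableSet_Ioi fun x hx ↦ ?_]
  · rw [NNReal.smul_def, Real.coe_toNNReal _ (pow_nonneg (le_of_lt hx) _), smul_eq_mul]
  · exact (measurable_subtype_coe.pow_const _).real_toNNReal

variable {μ}

theorem ae_integrableOn_polar {h : E → ℝ} (hh : Integrable h μ) :
    ∀ᵐ w : sphere (0 : E) 1 ∂μ.toSphere,
      IntegrableOn (fun s : ℝ => s ^ (Module.finrank ℝ E - 1) * h (s • (w : E))) (Ioi 0) := by
  filter_upwards [((integrable_polar_iff μ).2 hh).prod_right_ae] with w hw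
  exact (integrable_volumeIoiPow_iff (g := fun s => h (s • (w : E)))).1 hw

theorem integral_polar {h : E → ℝ} (hh : Integrable h μ) :
    ∫ x, h x ∂μ = ∫ w : sphere (0 : E) 1,
      (∫ s in Ioi (0 : ℝ), s ^ (Module.finrank ℝ E - 1) * h (s • (w : E))) ∂μ.toSphere := by
  rw [← integral_polar_prod, integral_prod _ ((integrable_polar_iff μ).2 hh)]
  exact integral_congr_ae (.of_forall fun w =>
    integral_volumeIoiPow fun s => h (s • (w : E)))

/-- Fubini supplies the integrability on almost every ray that the fundamental theorem of calculus
will require. -/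
theorem ae_integrableOn_polar_ball {R : ℝ} {h : E → ℝ} (hh : IntegrableOn h (ball 0 R) μ) :
    ∀ᵐ w : sphere (0 : E) 1 ∂μ.toSphere,
      IntegrableOn (fun s : ℝ => s ^ (Module.finrank ℝ E - 1) * h (s • (w : E))) (Ioo 0 R) := by
  filter_upwards [ae_integrableOn_polar ((integrable_indicator_iff measurableSet_ball).2 hh)]
    with w hw
  refine (hw.mono_set Ioo_subset_Ioi_self).congr_fun (fun s hs => ?_) measurableSet_Ioo
  have : s • (w : E) ∈ ball (0 : E) R := by simpa [norm_smul, abs_of_pos hs.1] using hs.2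
  simp [indicator_of_mem this]

theorem integral_polar_ball {R : ℝ} {h : E → ℝ} (hh : IntegrableOn h (ball 0 R) μ) :
    ∫ x in ball 0 R, h x ∂μ = ∫ w : sphere (0 : E) 1,
      (∫ s in Ioo (0 : ℝ) R, s ^ (Module.finrank ℝ E - 1) * h (s • (w : E))) ∂μ.toSphere := by
  rw [← integral_indicator measurableSet_ball,
    integral_polar ((integrable_indicator_iff measurableSet_ball).2 hh)]
  refine integral_congr_ae (.of_forall fun w => ?_)
  dsimp only
  rw [← integral_indicator measurableSet_Ioo, ← integral_indicator measurableSet_Ioi]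
  congr 1
  ext s
  by_cases hs : 0 < s
  · by_cases hsR : s < R
    · have : s • (w : E) ∈ ball (0 : E) R := by simpa [norm_smul, abs_of_pos hs] using hsR
      simp [indicator_of_mem this, hs, hsR]
    · have : s • (w : E) ∉ ball (0 : E) R := by
        simpa [norm_smul, abs_of_pos hs] using le_of_not_gt hsR
      simp [indicator_of_notMem this, hs, hsR]
  · simp [hs]

end PolarCoordinates

/-! ### Skew polar coordinates -/

section ConicalMap

theorem add_ne_zero_of_norm_lt {E : Type*} [NormedAddCommGroup E] {e w : E} (he : ‖e‖ < 1)
    (hw : ‖w‖ = 1) : w + e ≠ 0 := by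
  intro h
  rw [eq_neg_of_add_eq_zero_left h, norm_neg] at hw
  linarith

variable {E : Type*} [NormedAddCommGroup E] [InnerProductSpace ℝ E]

/-- The map `v ↦ v + ‖v‖ • e`, which carries the balls centred at the origin to the balls of the
same radius centred at the points of the ray through `e`. -/
def conicalMap (e v : E) : E := v + ‖v‖ • e

/-- Equal images force `v - v' = (‖v'‖ - ‖v‖) • e`, whose norm is at most `‖e‖ * ‖v - v'‖`. -/
theorem conicalMap_injective {e : E} (he : ‖e‖ < 1) : Function.Injective (conicalMap e) := by
  intro v v' h
  have h1 : v - v' = (‖v'‖ - ‖v‖) • e := by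
    simp only [conicalMap] at h
    rw [sub_smul, sub_eq_sub_iff_add_eq_add, h, add_comm]
  have h2 : ‖v - v'‖ ≤ ‖v - v'‖ * ‖e‖ := by
    conv_lhs => rw [h1, norm_smul, Real.norm_eq_abs]
    gcongr
    rw [norm_sub_rev]
    exact abs_norm_sub_norm_le v' v
  have h3 : ‖v - v'‖ = 0 := by nlinarith [norm_nonneg (v - v')]
  exact sub_eq_zero.1 (norm_eq_zero.1 h3)

/-- A preimage is `z - s • e` with `s = ‖z - s • e‖`; such an `s` comes from the intermediate value
theorem. The right endpoint solves `‖z‖ + s * ‖e‖ = s`. -/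
theorem exists_conicalMap_eq {e : E} (he : ‖e‖ < 1) (z : E) : ∃ v, conicalMap e v = z := by
  have hc : ContinuousOn (fun s : ℝ => ‖z - s • e‖ - s) (Icc 0 (‖z‖ / (1 - ‖e‖))) := by fun_prop
  have hpos : 0 < 1 - ‖e‖ := by linarith
  have h0 : (0 : ℝ) ≤ ‖z‖ / (1 - ‖e‖) := by positivity
  obtain ⟨s, hs, hs'⟩ := intermediate_value_Icc' h0 hc (show (0 : ℝ) ∈ _ from by
    constructor
    · have := norm_sub_le z ((‖z‖ / (1 - ‖e‖)) • e)
      rw [norm_smul, Real.norm_of_nonneg h0] at this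
      have h2 : ‖z‖ + ‖z‖ / (1 - ‖e‖) * ‖e‖ = ‖z‖ / (1 - ‖e‖) := by field_simp; ring
      linarith
    · simp)
  refine ⟨z - s • e, ?_⟩
  have : ‖z - s • e‖ = s := by simpa [sub_eq_zero] using hs'
  simp [conicalMap, this]

/-- The vector on the left is `v + (‖v‖ - R) • e`, and since `‖e‖ < 1` the perturbation is too short
to carry `v` across the sphere of radius `R`. -/
theorem norm_conicalMap_sub_lt_iff {e : E} (he : ‖e‖ < 1) {R : ℝ} (v : E) :
    ‖conicalMap e v - R • e‖ < R ↔ ‖v‖ < R := by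
  have h1 : conicalMap e v - R • e = v + (‖v‖ - R) • e := by
    simp only [conicalMap, sub_smul]; abel
  rw [h1]
  constructor
  · intro h
    by_contra! hR
    have h2 := norm_sub_norm_le v (-((‖v‖ - R) • e))
    rw [sub_neg_eq_add, norm_neg, norm_smul, Real.norm_of_nonneg (by linarith)] at h2
    nlinarith [norm_nonneg e]
  · intro h
    have h2 := norm_add_le v ((‖v‖ - R) • e)
    rw [norm_smul, Real.norm_of_nonpos (by linarith)] at h2
    nlinarith [norm_nonneg e]

theorem conicalMap_image_ball {e : E} (he : ‖e‖ < 1) (R : ℝ) :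
    conicalMap e '' (ball 0 R \ {0}) = ball (R • e) R \ {0} := by
  ext z
  constructor
  · rintro ⟨v, ⟨hv, hv0⟩, rfl⟩
    refine ⟨?_, fun h => hv0 (conicalMap_injective he ?_)⟩
    · rw [mem_ball, dist_eq_norm, norm_conicalMap_sub_lt_iff he]
      simpa using hv
    · rw [mem_singleton_iff.1 h]
      simp [conicalMap]
  · rintro ⟨hz, hz0⟩
    obtain ⟨v, rfl⟩ := exists_conicalMap_eq he z
    rw [mem_ball, dist_eq_norm, norm_conicalMap_sub_lt_iff he] at hz
    refine ⟨v, ⟨by simpa using hz, ?_⟩, rfl⟩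
    rintro rfl
    exact hz0 (by simp [conicalMap])

theorem conicalMap_smul (e w : E) (hw : ‖w‖ = 1) {s : ℝ} (hs : 0 ≤ s) :
    conicalMap e (s • w) = s • (w + e) := by
  simp [conicalMap, norm_smul, hw, abs_of_nonneg hs]

theorem hasFDerivAt_conicalMap (e : E) {v : E} (hv : v ≠ 0) :
    HasFDerivAt (conicalMap e)
      (ContinuousLinearMap.id ℝ E + (‖v‖⁻¹ • innerSL ℝ v).smulRight e) v := by
  have h1 : HasFDerivAt (fun v : E => ‖v‖) (‖v‖⁻¹ • innerSL ℝ v) v := by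
    have := ((hasStrictFDerivAt_norm_sq v).hasFDerivAt.sqrt (by simpa using hv))
    simp only [Real.sqrt_sq (norm_nonneg _)] at this
    convert! this using 1
    ext x
    simp
    field_simp
  exact (hasFDerivAt_id v).add (h1.smul_const e)

/-- Rank-one update of the identity; it yields the Jacobian `1 + ⟨v / ‖v‖, e⟩` of `conicalMap e`. -/
theorem det_id_add_smulRight [FiniteDimensional ℝ E] (l : E →L[ℝ] ℝ) (e : E) :
    (ContinuousLinearMap.id ℝ E + l.smulRight e).det = 1 + l e :=
  LinearMap.transvection.det (l : E →ₗ[ℝ] ℝ) e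

theorem one_add_inner_pos {e w : E} (he : ‖e‖ < 1) (hw : ‖w‖ ≤ 1) : 0 < 1 + inner ℝ w e := by
  have h1 := abs_le.1 (abs_real_inner_le_norm w e)
  nlinarith [h1.1, norm_nonneg w, norm_nonneg e]

variable [FiniteDimensional ℝ E] [MeasurableSpace E] [BorelSpace E] [Nontrivial E]
  {μ : Measure E} [μ.IsAddHaarMeasure]

/-- Change of variables along `conicalMap e`. The origin, where the norm is not differentiable, is
removed as a null set. -/
theorem integrableOn_comp_conicalMap {e : E} (he : ‖e‖ < 1) {R : ℝ} {g : E → ℝ}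
    (hg : IntegrableOn g (ball (R • e) R) μ) :
    IntegrableOn (fun v => (1 + ‖v‖⁻¹ * inner ℝ v e) * g (conicalMap e v)) (ball 0 R) μ ∧
    ∫ v in ball 0 R, (1 + ‖v‖⁻¹ * inner ℝ v e) * g (conicalMap e v) ∂μ =
      ∫ x in ball (R • e) R, g x ∂μ := by
  have hs : MeasurableSet (ball (0 : E) R \ {0}) :=
    measurableSet_ball.diff (measurableSet_singleton _)
  have hd : ∀ v ∈ ball (0 : E) R \ {0}, HasFDerivWithinAt (conicalMap e)
      (ContinuousLinearMap.id ℝ E + (‖v‖⁻¹ • innerSL ℝ v).smulRight e) (ball (0 : E) R \ {0}) v :=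
    fun v hv => (hasFDerivAt_conicalMap e hv.2).hasFDerivWithinAt
  have hi := (conicalMap_injective he).injOn (s := ball (0 : E) R \ {0})
  have hdet : ∀ v ∈ ball (0 : E) R \ {0},
      |(ContinuousLinearMap.id ℝ E + (‖v‖⁻¹ • innerSL ℝ v).smulRight e).det| •
        g (conicalMap e v) = (1 + ‖v‖⁻¹ * inner ℝ v e) * g (conicalMap e v) := by
    intro v hv
    have hv0 : ‖v‖ ≠ 0 := norm_ne_zero_iff.2 hv.2
    have h1 : 0 < 1 + inner ℝ (‖v‖⁻¹ • v) e :=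
      one_add_inner_pos he (by simp [norm_smul, hv0])
    rw [real_inner_smul_left] at h1
    rw [det_id_add_smulRight]
    simp [abs_of_pos h1]
  have hnull : ∀ c : E, (ball c R \ {0} : Set E) =ᵐ[μ] ball c R :=
    fun c => sdiff_null_ae_eq_self (measure_singleton _)
  have hint := (integrableOn_image_iff_integrableOn_abs_det_fderiv_smul μ hs hd hi g).1
    (by rw [conicalMap_image_ball he]; exact hg.mono_set sdiff_subset)
  have heq := integral_image_eq_integral_abs_det_fderiv_smul μ hs hd hi g
  rw [conicalMap_image_ball he, setIntegral_congr_set (hnull _),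
    setIntegral_congr_fun hs hdet, setIntegral_congr_set (hnull _)] at heq
  refine ⟨?_, heq.symm⟩
  rw [integrableOn_congr_fun hdet hs] at hint
  exact hint.congr_set_ae (hnull 0).symm

theorem skew_polar_ball {e : E} (he : ‖e‖ < 1) {R : ℝ} {g : E → ℝ}
    (hg : IntegrableOn g (ball (R • e) R) μ) :
    (∀ᵐ w : sphere (0 : E) 1 ∂μ.toSphere, IntegrableOn (fun s : ℝ =>
      s ^ (Module.finrank ℝ E - 1) * ((1 + inner ℝ (w : E) e) * g (s • ((w : E) + e))))
      (Ioo 0 R)) ∧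
    ∫ x in ball (R • e) R, g x ∂μ = ∫ w : sphere (0 : E) 1, (∫ s in Ioo (0 : ℝ) R,
      s ^ (Module.finrank ℝ E - 1) * ((1 + inner ℝ (w : E) e) * g (s • ((w : E) + e))))
      ∂μ.toSphere := by
  obtain ⟨h1, h2⟩ := integrableOn_comp_conicalMap he hg
  have h3 : ∀ w : sphere (0 : E) 1, ∀ s ∈ Ioo 0 R, s ^ (Module.finrank ℝ E - 1) *
      ((1 + ‖s • (w : E)‖⁻¹ * inner ℝ (s • (w : E)) e) * g (conicalMap e (s • (w : E)))) =
      s ^ (Module.finrank ℝ E - 1) * ((1 + inner ℝ (w : E) e) * g (s • ((w : E) + e))) := by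
    intro w s hs
    have hw : ‖(w : E)‖ = 1 := by simp
    have hs0 : s ≠ 0 := hs.1.ne'
    rw [conicalMap_smul e _ hw hs.1.le, norm_smul, hw, real_inner_smul_left,
      Real.norm_of_nonneg hs.1.le, mul_one, inv_mul_cancel_left₀ hs0]
  constructor
  · filter_upwards [ae_integrableOn_polar_ball h1] with w hw
    exact hw.congr_fun (h3 w) measurableSet_Ioo
  · rw [← h2, integral_polar_ball h1]
    exact integral_congr_ae (.of_forall fun w => setIntegral_congr_fun measurableSet_Ioo (h3 w))

/-- The unit ball is measured in skew coordinates: the ray along `w + e` leaves it at `s = 1 / ‖w +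
e‖`, so its volume is `1 / n` times the integral on the left, while it is also `1 / n` times the
area of the sphere. -/
theorem integral_one_add_inner_div_norm_pow {e : E} (he : ‖e‖ < 1) :
    ∫ w : sphere (0 : E) 1, (1 + inner ℝ (w : E) e) / ‖(w : E) + e‖ ^ Module.finrank ℝ E
      ∂μ.toSphere = μ.toSphere.real univ := by
  set n := Module.finrank ℝ E with hn
  have hnpos : 0 < n := Module.finrank_pos
  have hpos : 0 < 1 - ‖e‖ := by linarith
  -- Chosen so that `1 + R * ‖e‖ = R`, which puts the unit ball inside `ball (R • e) R`.
  set R := (1 - ‖e‖)⁻¹ with hRdef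
  have hR : 0 < R := by positivity
  have hsub : ball (0 : E) 1 ⊆ ball (R • e) R := by
    intro x hx
    rw [mem_ball, dist_eq_norm]
    have h1 := norm_sub_le x (R • e)
    rw [norm_smul, Real.norm_of_nonneg hR.le] at h1
    have h2 : 1 + R * ‖e‖ = R := by rw [hRdef]; field_simp; ring
    have h3 : ‖x‖ < 1 := by simpa using hx
    linarith
  have hg : IntegrableOn ((ball (0 : E) 1).indicator fun _ => (1 : ℝ)) (ball (R • e) R) μ :=
    ((integrable_indicator_iff measurableSet_ball).2
      (integrableOn_const measure_ball_lt_top.ne)).integrableOn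
  have h1 := (skew_polar_ball he hg).2
  rw [setIntegral_indicator measurableSet_ball, inter_eq_self_of_subset_right hsub] at h1
  simp only [integral_const, smul_eq_mul, mul_one, measureReal_restrict_apply_univ] at h1
  rw [Measure.toSphere_real_apply_univ, h1, ← hn, ← integral_const_mul]
  refine integral_congr_ae (.of_forall fun w => ?_)
  have hw : ‖(w : E)‖ = 1 := by simp
  have hw0 : 0 < ‖(w : E) + e‖ := norm_pos_iff.2 (add_ne_zero_of_norm_lt he hw)
  have hle : ‖(w : E) + e‖⁻¹ ≤ R := by
    rw [hRdef]
    gcongr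
    have := norm_sub_norm_le (w : E) (-e)
    rw [norm_neg, sub_neg_eq_add, hw] at this
    exact this
  have h4 : ∀ s ∈ Ioo 0 R, s ^ (n - 1) * ((1 + inner ℝ (w : E) e) *
      (ball (0 : E) 1).indicator (fun _ => (1 : ℝ)) (s • ((w : E) + e))) =
      (Ioo 0 (‖(w : E) + e‖⁻¹)).indicator (fun s => (1 + inner ℝ (w : E) e) * s ^ (n - 1)) s := by
    intro s hs
    have hmem : s • ((w : E) + e) ∈ ball (0 : E) 1 ↔ s ∈ Ioo 0 (‖(w : E) + e‖⁻¹) := by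
      simp only [mem_ball, dist_zero_right, norm_smul, Real.norm_of_nonneg hs.1.le, mem_Ioo, hs.1,
        true_and]
      rw [← lt_div_iff₀ hw0, one_div]
    by_cases h : s ∈ Ioo 0 (‖(w : E) + e‖⁻¹)
    · rw [indicator_of_mem h, indicator_of_mem (hmem.2 h)]; ring
    · rw [indicator_of_notMem h, indicator_of_notMem (mt hmem.1 h)]; ring
  dsimp only
  rw [setIntegral_congr_fun measurableSet_Ioo h4, setIntegral_indicator measurableSet_Ioo,
    inter_eq_self_of_subset_right (Ioo_subset_Ioo_right hle), integral_const_mul,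
    ← integral_Ioc_eq_integral_Ioo, ← intervalIntegral.integral_of_le (by positivity),
    integral_pow]
  have h5 : n - 1 + 1 = n := by omega
  have h6 : ((n - 1 : ℕ) : ℝ) + 1 = n := by exact_mod_cast h5
  rw [h5, h6, zero_pow hnpos.ne', inv_pow]
  field_simp
  ring

end ConicalMap

/-! ### Moving the base point to the origin -/

section Translation

variable {E : Type*} [NormedAddCommGroup E] [MeasurableSpace E] [BorelSpace E] {μ : Measure E}
  [μ.IsAddLeftInvariant] {R : ℝ}

theorem integrableOn_ball_comp_add {c : E} {h : E → ℝ} (hh : IntegrableOn h (ball c R) μ) (y : E) :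
    IntegrableOn (fun z => h (y + z)) (ball (c - y) R) μ := by
  have := ((measurePreserving_add_left μ y).integrableOn_comp_preimage
    (measurableEmbedding_addLeft y)).2 hh
  rwa [preimage_add_ball] at this

theorem setIntegral_ball_comp_add (c y : E) (h : E → ℝ) :
    ∫ z in ball (c - y) R, h (y + z) ∂μ = ∫ x in ball c R, h x ∂μ := by
  have := (measurePreserving_add_left μ y).setIntegral_preimage_emb
    (measurableEmbedding_addLeft y) h (ball c R)
  rwa [preimage_add_ball] at this

end Translation

/-! ### Integration along segments -/

section RayIntegration

variable {E : Type*} [NormedAddCommGroup E] [InnerProductSpace ℝ E]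

theorem countable_ray_preimage {S : Set E} (hS : S.Countable) (y : E) {u : E} (hu : u ≠ 0) :
    {s : ℝ | y + s • u ∈ S}.Countable :=
  hS.preimage ((add_right_injective y).comp (smul_left_injective ℝ hu))

/-- A convex combination of an interior point, with positive weight, and a point of the closed ball
is interior. -/
theorem ray_mem_ball {a y u : E} {R s : ℝ} (hy : y ∈ ball a R) (hyR : y + R • u ∈ closedBall a R)
    (hs : s ∈ Ico 0 R) : y + s • u ∈ ball a R := by
  have hR : 0 < R := hs.1.trans_lt hs.2
  have h : y + s • u = (1 - s / R) • y + (s / R) • (y + R • u) := by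
    rw [smul_add, smul_smul, div_mul_cancel₀ _ hR.ne', sub_smul, one_smul]; abel
  have h1 : 0 < 1 - s / R := by rw [sub_pos, div_lt_one hR]; exact hs.2
  have := (convex_closedBall a R).combo_interior_closure_mem_interior
    (x := y) (y := y + R • u) (by rwa [interior_closedBall _ hR.ne'])
    (by rwa [isClosed_closedBall.closure_eq]) h1 (div_nonneg hs.1 hR.le) (by ring)
  rwa [interior_closedBall _ hR.ne', ← h] at this

variable {a y : E} {R : ℝ} {f : E → ℝ} {G : E → E} {S : Set E}

theorem continuousOn_ray (hfc : ContinuousOn f (closedBall a R)) (hy : y ∈ ball a R) {u : E}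
    (hyR : y + R • u ∈ closedBall a R) : ContinuousOn (fun s : ℝ => f (y + s • u)) (Icc 0 R) := by
  refine hfc.comp (by fun_prop) fun s hs => ?_
  rcases hs.2.lt_or_eq with h | h
  · exact ball_subset_closedBall (ray_mem_ball hy hyR ⟨hs.1, h⟩)
  · rw [h]; exact hyR

theorem continuous_comp_sphere (hR : 0 ≤ R) (hfc : ContinuousOn f (closedBall a R)) :
    Continuous fun w : sphere (0 : E) 1 => f (a + R • (w : E)) :=
  hfc.comp_continuous (by fun_prop) fun w => by
    simp [mem_closedBall, dist_eq_norm, norm_smul, abs_of_nonneg hR]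

variable [FiniteDimensional ℝ E]

theorem hasDerivAt_ray (hfd : ∀ x ∈ ball a R \ S, HasGradientAt f (G x) x) (hy : y ∈ ball a R)
    {u : E} (hyR : y + R • u ∈ closedBall a R) {s : ℝ} (hs : s ∈ Ioo 0 R)
    (hsS : y + s • u ∉ S) :
    HasDerivAt (fun s : ℝ => f (y + s • u)) (inner ℝ (G (y + s • u)) u) s := by
  have h1 := (hfd _ ⟨ray_mem_ball hy hyR ⟨hs.1.le, hs.2⟩, hsS⟩).hasFDerivAt
  have h2 : HasDerivAt (fun s : ℝ => y + s • u) u s := by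
    simpa using ((hasDerivAt_id s).smul_const u).const_add y
  simpa [Function.comp_def] using h1.comp_hasDerivAt s h2

theorem integral_inner_ray (hR : 0 < R) (hS : S.Countable)
    (hfc : ContinuousOn f (closedBall a R))
    (hfd : ∀ x ∈ ball a R \ S, HasGradientAt f (G x) x) (hy : y ∈ ball a R)
    {u : E} (hu : u ≠ 0) (hyR : y + R • u ∈ closedBall a R)
    (hi : IntegrableOn (fun s : ℝ => inner ℝ (G (y + s • u)) u) (Ioo 0 R)) :
    ∫ s in Ioo 0 R, inner ℝ (G (y + s • u)) u = f (y + R • u) - f y := by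
  have := integral_eq_of_hasDerivAt_off_countable_of_le _ _ hR.le
    (countable_ray_preimage hS y hu) (continuousOn_ray hfc hy hyR)
    (fun s hs => hasDerivAt_ray hfd hy hyR hs.1 hs.2)
    ((intervalIntegrable_iff_integrableOn_Ioo_of_le hR.le).2 hi)
  rw [← integral_Ioc_eq_integral_Ioo, ← intervalIntegral.integral_of_le hR.le, this]
  simp

/-- The integrand is the derivative of `s ^ n * f (y + s • u)`, which vanishes at `s = 0` because `n
≠ 0`. -/
theorem integral_pow_mul_ray (hR : 0 < R) (hS : S.Countable)
    (hfc : ContinuousOn f (closedBall a R))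
    (hfd : ∀ x ∈ ball a R \ S, HasGradientAt f (G x) x) (hy : y ∈ ball a R)
    {u : E} (hu : u ≠ 0) (hyR : y + R • u ∈ closedBall a R) {n : ℕ} (hn : n ≠ 0)
    (hi : IntegrableOn (fun s : ℝ => s ^ (n - 1) *
      (inner ℝ (G (y + s • u)) (s • u) + n * f (y + s • u))) (Ioo 0 R)) :
    ∫ s in Ioo 0 R, s ^ (n - 1) * (inner ℝ (G (y + s • u)) (s • u) + n * f (y + s • u)) =
      R ^ n * f (y + R • u) := by
  have := integral_eq_of_hasDerivAt_off_countable_of_le (fun s : ℝ => s ^ n * f (y + s • u)) _ hR.le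
    (countable_ray_preimage hS y hu)
    (ContinuousOn.mul (by fun_prop) (continuousOn_ray hfc hy hyR))
    (fun s hs => by
      convert! (hasDerivAt_pow n s).mul (hasDerivAt_ray hfd hy hyR hs.1 hs.2) using 1
      rw [real_inner_smul_right, mul_add, ← mul_assoc, ← pow_succ, Nat.sub_add_cancel
        (Nat.one_le_iff_ne_zero.2 hn)]
      ring)
    ((intervalIntegrable_iff_integrableOn_Ioo_of_le hR.le).2 hi)
  rw [← integral_Ioc_eq_integral_Ioo, ← intervalIntegral.integral_of_le hR.le, this]
  simp [hn]

variable [MeasurableSpace E] [BorelSpace E] {μ : Measure E} [μ.IsAddHaarMeasure]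

theorem integrable_sphere_of_continuous {g : sphere (0 : E) 1 → ℝ} (hg : Continuous g) :
    Integrable g μ.toSphere :=
  hg.integrable_of_hasCompactSupport (HasCompactSupport.of_compactSpace g)

variable [Nontrivial E]

/-- This is the divergence theorem for the field `f(x) (x - a)`, obtained radius by radius, so no
regularity of `G` beyond integrability of the divergence is needed. -/
theorem integral_inner_add_ball (hR : 0 < R) (hS : S.Countable)
    (hfc : ContinuousOn f (closedBall a R))
    (hfd : ∀ x ∈ ball a R \ S, HasGradientAt f (G x) x)
    (hi : IntegrableOn (fun x => inner ℝ (G x) (x - a) + Module.finrank ℝ E * f x)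
      (ball a R) μ) :
    ∫ x in ball a R, (inner ℝ (G x) (x - a) + Module.finrank ℝ E * f x) ∂μ =
      R ^ Module.finrank ℝ E * ∫ w : sphere (0 : E) 1, f (a + R • (w : E)) ∂μ.toSphere := by
  have h1 := integrableOn_ball_comp_add hi a
  rw [← setIntegral_ball_comp_add a a, ← integral_const_mul]
  rw [sub_self] at h1 ⊢
  rw [integral_polar_ball h1]
  refine integral_congr_ae ?_
  filter_upwards [ae_integrableOn_polar_ball h1] with w hw
  simp only [add_sub_cancel_left] at hw ⊢
  have hw1 : ‖(w : E)‖ = 1 := by simp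
  exact integral_pow_mul_ray hR hS hfc hfd (mem_ball_self hR)
    (norm_ne_zero_iff.1 (by rw [hw1]; exact one_ne_zero))
    (by simp [mem_closedBall, dist_eq_norm, norm_smul, abs_of_pos hR])
    Module.finrank_pos.ne' hw

theorem integral_inner_div_norm_pow_ball (hR : 0 < R) (hS : S.Countable)
    (hfc : ContinuousOn f (closedBall a R))
    (hfd : ∀ x ∈ ball a R \ S, HasGradientAt f (G x) x) (hy : y ∈ ball a R)
    (hi : IntegrableOn (fun x => inner ℝ (G x) (x - y) / ‖x - y‖ ^ Module.finrank ℝ E)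
      (ball a R) μ) {e : E} (hRe : R • e = a - y) :
    ∫ x in ball a R, inner ℝ (G x) (x - y) / ‖x - y‖ ^ Module.finrank ℝ E ∂μ =
      (∫ w : sphere (0 : E) 1, f (a + R • (w : E)) *
        ((1 + inner ℝ (w : E) e) / ‖(w : E) + e‖ ^ Module.finrank ℝ E) ∂μ.toSphere) -
      μ.toSphere.real univ * f y := by
  have he : ‖e‖ < 1 := by
    have h1 : ‖a - y‖ < R := by rwa [mem_ball', dist_eq_norm] at hy
    rw [← hRe, norm_smul, Real.norm_of_nonneg hR.le] at h1
    nlinarith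
  have hw0 : ∀ w : sphere (0 : E) 1, (w : E) + e ≠ 0 :=
    fun w => add_ne_zero_of_norm_lt he (by simp)
  have hk : Continuous fun w : sphere (0 : E) 1 =>
      (1 + inner ℝ (w : E) e) / ‖(w : E) + e‖ ^ Module.finrank ℝ E :=
    Continuous.div (by fun_prop) (by fun_prop) fun w => pow_ne_zero _ (norm_ne_zero_iff.2 (hw0 w))
  have hfk : Integrable (fun w : sphere (0 : E) 1 => f (a + R • (w : E)) *
      ((1 + inner ℝ (w : E) e) / ‖(w : E) + e‖ ^ Module.finrank ℝ E)) μ.toSphere :=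
    integrable_sphere_of_continuous ((continuous_comp_sphere hR.le hfc).mul hk)
  have h1 := integrableOn_ball_comp_add hi y
  rw [← hRe] at h1
  obtain ⟨h2, h3⟩ := skew_polar_ball he h1
  rw [← setIntegral_ball_comp_add a y, ← hRe, h3, ← integral_one_add_inner_div_norm_pow he,
    ← integral_mul_const, ← integral_sub hfk ((integrable_sphere_of_continuous hk).mul_const _)]
  refine integral_congr_ae ?_
  filter_upwards [h2] with w hw
  have hpos : 0 < 1 + inner ℝ (w : E) e := one_add_inner_pos he (by simp)
  have hnorm : 0 < ‖(w : E) + e‖ := norm_pos_iff.2 (hw0 w)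
  have hend : y + R • ((w : E) + e) = a + R • (w : E) := by rw [smul_add, hRe]; abel
  -- The factor `s ^ (n - 1)` from the volume, `s` from `x - y` and `s ^ (-n)` from the kernel
  -- cancel.
  have h4 : ∀ s ∈ Ioo 0 R, s ^ (Module.finrank ℝ E - 1) * ((1 + inner ℝ (w : E) e) *
      (inner ℝ (G (y + s • ((w : E) + e))) (y + s • ((w : E) + e) - y) /
        ‖y + s • ((w : E) + e) - y‖ ^ Module.finrank ℝ E)) =
      (1 + inner ℝ (w : E) e) / ‖(w : E) + e‖ ^ Module.finrank ℝ E *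
        inner ℝ (G (y + s • ((w : E) + e))) ((w : E) + e) := by
    intro s hs
    have hs0 := hs.1
    have h5 : s ^ Module.finrank ℝ E = s ^ (Module.finrank ℝ E - 1) * s := by
      rw [← pow_succ, Nat.sub_add_cancel Module.finrank_pos]
    rw [add_sub_cancel_left, real_inner_smul_right, norm_smul, Real.norm_of_nonneg hs.1.le,
      mul_pow, h5]
    field_simp
  rw [setIntegral_congr_fun measurableSet_Ioo h4, integral_const_mul]
  rw [integrableOn_congr_fun h4 measurableSet_Ioo] at hw
  -- The weight is nonzero, so integrability of the weighted derivative gives that of the derivative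
  -- itself.
  have hc : (1 + inner ℝ (w : E) e) / ‖(w : E) + e‖ ^ Module.finrank ℝ E ≠ 0 := by positivity
  have hw' := (integrable_const_mul_iff hc.isUnit _).1 hw
  rw [integral_inner_ray hR hS hfc hfd hy (hw0 w) (by
    rw [hend]; simp [mem_closedBall, dist_eq_norm, norm_smul, abs_of_pos hR]) hw', hend]
  ring

end RayIntegration

/-! ### The classical gradient is the weak gradient -/

section WeakGradient

theorem integrable_mul_of_tsupport_subset {X : Type*} [TopologicalSpace X] [T2Space X]
    [MeasurableSpace X] [OpensMeasurableSpace X] {ν : Measure X} [IsFiniteMeasureOnCompacts ν]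
    {U : Set X} {h ψ : X → ℝ} (hh : ContinuousOn h U) (hψ : Continuous ψ)
    (hc : HasCompactSupport ψ) (hs : tsupport ψ ⊆ U) : Integrable (fun x => h x * ψ x) ν := by
  have h1 : IntegrableOn (fun x => h x * ψ x) (tsupport ψ) ν :=
    ((hh.mono hs).mul hψ.continuousOn).integrableOn_compact hc
  refine (integrableOn_iff_integrable_of_support_subset fun x hx => ?_).1 h1
  exact subset_tsupport _ fun h0 => hx (by simp [h0])

variable {N : ℕ} {Ω : Set (EuclideanSpace ℝ (Fin N))} {f : EuclideanSpace ℝ (Fin N) → ℝ}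
  {p : ℝ≥0∞}

/-- Classical integration by parts against test functions supported in `U` shows that the difference
of the two derivatives annihilates all of them. -/
theorem fderiv_ae_eq_of_weak_deriv {U : Set (EuclideanSpace ℝ (Fin N))} (hU : IsOpen U)
    (hUΩ : U ⊆ Ω) (hfd : ContDiffOn ℝ 1 f U) {v : EuclideanSpace ℝ (Fin N)}
    {g : EuclideanSpace ℝ (Fin N) → ℝ} (hg : LocallyIntegrableOn g U)
    (hw : ∀ φ : EuclideanSpace ℝ (Fin N) → ℝ, ContDiff ℝ ∞ φ → HasCompactSupport φ →
      tsupport φ ⊆ U → ∫ x in Ω, f x * fderiv ℝ φ x v = -∫ x in Ω, g x * φ x) :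
    ∀ᵐ x, x ∈ U → fderiv ℝ f x v = g x := by
  have hder : ContinuousOn (fun x => fderiv ℝ f x v) U :=
    (hfd.continuousOn_fderiv_of_isOpen hU le_rfl).clm_apply continuousOn_const
  have key : ∀ᵐ x, x ∈ U → fderiv ℝ f x v - g x = 0 := by
    refine hU.ae_eq_zero_of_integral_contDiff_smul_eq_zero
      ((hder.locallyIntegrableOn hU.measurableSet).sub hg) fun φ hφ hφc hφs => ?_
    have hφ1 : Continuous fun x => fderiv ℝ φ x v :=
      (hφ.continuous_fderiv (by simp)).clm_apply continuous_const
    have hts : tsupport (fun x => fderiv ℝ φ x v) ⊆ tsupport φ := by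
      refine closure_minimal (fun x hx => ?_) (isClosed_tsupport _)
      by_contra h
      exact hx (by simp [fderiv_of_notMem_tsupport ℝ h])
    have hi1 : Integrable (fun x => fderiv ℝ f x v * φ x) :=
      integrable_mul_of_tsupport_subset hder hφ.continuous hφc hφs
    have hi2 : Integrable (fun x => f x * fderiv ℝ φ x v) :=
      integrable_mul_of_tsupport_subset hfd.continuousOn hφ1
        (hφc.mono' (subset_closure.trans hts)) (hts.trans hφs)
    have hi3 : Integrable (fun x => g x * φ x) := by
      have h1 : IntegrableOn (fun x => g x * φ x) (tsupport φ) :=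
        (hg.integrableOn_compact_subset hφs hφc).mul_continuousOn hφ.continuous.continuousOn hφc
      refine (integrableOn_iff_integrable_of_support_subset fun x hx => ?_).1 h1
      exact subset_tsupport _ fun h0 => hx (by simp [h0])
    have hparts := integral_mul_fderiv_eq_neg_fderiv_mul_of_integrable hi1 hi2
      (integrable_mul_of_tsupport_subset hfd.continuousOn hφ.continuous hφc hφs)
      (fun x hx => (hfd.differentiableOn one_ne_zero).differentiableAt (hU.mem_nhds (hφs hx)))
      (fun x _ => hφ.differentiable (by simp) x)
    have hweak := hw φ hφ hφc hφs
    rw [setIntegral_eq_integral_of_forall_compl_eq_zero, hparts,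
      setIntegral_eq_integral_of_forall_compl_eq_zero] at hweak
    · calc ∫ x, φ x • (fderiv ℝ f x v - g x)
          = ∫ x, (fderiv ℝ f x v * φ x - g x * φ x) := by
            congr 1; ext x; simp only [smul_eq_mul]; ring
        _ = 0 := by rw [integral_sub hi1 hi3]; linarith
    · intro x hx
      rw [image_eq_zero_of_notMem_tsupport fun h => hx (hUΩ (hφs h)), mul_zero]
    · intro x hx
      rw [fderiv_of_notMem_tsupport ℝ fun h => hx (hUΩ (hφs h))]
      simp
  filter_upwards [key] with x hx hxU
  exact sub_eq_zero.1 (hx hxU)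

/-- Testing only on `Ω \ A` identifies the derivatives there, and the finite set `A` is null since
the dimension is positive. -/
theorem MemSobolevOne.memLp_gradient (hΩ : IsOpen Ω)
    {A : Finset (EuclideanSpace ℝ (Fin N))} (hNpos : 1 ≤ N) (hfd : ContDiffOn ℝ 1 f (Ω \ A))
    (hp : 1 ≤ p) (hfW : MemSobolevOne p Ω f) : MemLp (gradient f) p (volume.restrict Ω) := by
  obtain ⟨-, g, hg⟩ := hfW
  have : Nonempty (Fin N) := ⟨⟨0, hNpos⟩⟩
  have hU : IsOpen (Ω \ A) := hΩ.sdiff A.finite_toSet.isClosed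
  refine MemLp.of_eval_piLp fun i => (memLp_congr_ae ?_).2 (hg i).1
  have hgi : LocallyIntegrableOn (g i) (Ω \ A) := by
    refine LocallyIntegrableOn.mono_set ?_ sdiff_subset
    exact locallyIntegrableOn_of_locallyIntegrable_restrict ((hg i).1.locallyIntegrable hp)
  have h1 := fderiv_ae_eq_of_weak_deriv hU sdiff_subset hfd hgi
    fun φ h1 h2 h3 => (hg i).2 φ h1 h2 (h3.trans sdiff_subset)
  have h2 : ∀ᵐ x, x ∉ (A : Set (EuclideanSpace ℝ (Fin N))) :=
    measure_eq_zero_iff_ae_notMem.1 (A.finite_toSet.measure_zero _)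
  rw [EventuallyEq, ae_restrict_iff' hΩ.measurableSet]
  filter_upwards [h1, h2] with x hx hxA hxΩ
  rw [← hx ⟨hxΩ, hxA⟩, ← InnerProductSpace.toDual_symm_apply, real_inner_comm,
    EuclideanSpace.inner_single_left]
  simp [gradient]

end WeakGradient

/-! ### Integrability of the singular kernel -/

section Kernel

variable {E : Type*} [NormedAddCommGroup E] [InnerProductSpace ℝ E] [FiniteDimensional ℝ E]
  [MeasurableSpace E] [BorelSpace E] {μ : Measure E} [μ.IsAddHaarMeasure]

theorem integrableOn_inner_sub {p : ℝ≥0∞} (hp : 1 ≤ p) {G : E → E} {a : E} {R : ℝ}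
    (hG : MemLp G p (μ.restrict (ball a R))) :
    IntegrableOn (fun x => inner ℝ (G x) (x - a)) (ball a R) μ := by
  have : IsFiniteMeasure (μ.restrict (ball a R)) :=
    isFiniteMeasure_restrict.2 measure_ball_lt_top.ne
  have h1 : AEStronglyMeasurable (fun x : E => x - a) (μ.restrict (ball a R)) := by fun_prop
  refine ((hG.integrable hp).norm.mul_const R).mono' (hG.1.inner h1) ?_
  filter_upwards [ae_restrict_mem measurableSet_ball] with x hx
  refine (norm_inner_le_norm _ _).trans ?_
  gcongr
  exact (mem_ball_iff_norm.1 hx).le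

variable [Nontrivial E]

theorem memLp_norm_pow_inv_ball {n : ℕ} (hn : Module.finrank ℝ E = n + 1) {q : ℝ} (hq0 : 0 < q)
    (hq : n * (q - 1) < 1) (r : ℝ) :
    MemLp (fun x : E => (‖x‖ ^ n)⁻¹) (ENNReal.ofReal q) (μ.restrict (ball 0 r)) := by
  have hm : AEStronglyMeasurable (fun x : E => (‖x‖ ^ n)⁻¹) (μ.restrict (ball 0 r)) :=
    ((measurable_norm.pow_const n).inv).aestronglyMeasurable
  rw [← integrable_norm_rpow_iff hm (by simpa using hq0) ENNReal.ofReal_ne_top,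
    ENNReal.toReal_ofReal hq0.le]
  change IntegrableOn (fun x : E => ‖(‖x‖ ^ n)⁻¹‖ ^ q) (ball 0 r) μ
  rw [integrableOn_fun_norm_addHaar μ (f := fun t : ℝ => ‖(t ^ n)⁻¹‖ ^ q), hn,
    Nat.add_sub_cancel]
  rcases le_or_gt r 0 with hr | hr
  · simp [Ioo_eq_empty_of_le hr]
  -- The radial integrand is `t ^ n * t ^ (-n * q) = t ^ (-n * (q - 1))`.
  refine ((intervalIntegral.integrableOn_Ioo_rpow_iff hr).2
    (show -1 < -(n * (q - 1)) by linarith)).congr_fun (fun t ht => ?_) measurableSet_Ioo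
  have ht0 : 0 < t := ht.1
  dsimp only
  rw [Real.norm_of_nonneg (by positivity), smul_eq_mul, Real.inv_rpow (by positivity),
    ← Real.rpow_natCast, ← Real.rpow_mul ht0.le, ← Real.rpow_neg ht0.le, ← Real.rpow_add ht0]
  congr 1
  ring

theorem integrableOn_norm_mul_norm_sub_pow_inv {n : ℕ} (hn : Module.finrank ℝ E = n + 1)
    {p : ℝ≥0∞} (hp : ((n + 1 : ℕ) : ℝ≥0∞) < p) {G : E → E} {a : E} {R : ℝ}
    (hG : MemLp G p (μ.restrict (ball a R))) (y : E) :
    IntegrableOn (fun x => ‖G x‖ * (‖x - y‖ ^ n)⁻¹) (ball a R) μ := by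
  -- A finite exponent covers the case `p = ∞`; lowering the exponent is harmless on a ball of
  -- finite measure.
  obtain ⟨p', hp'1, hp'2⟩ := exists_between hp
  have hp'top : p' ≠ ⊤ := (hp'2.trans_le le_top).ne
  set P := p'.toReal with hP
  have hPp : ENNReal.ofReal P = p' := ENNReal.ofReal_toReal hp'top
  have hnP : (n : ℝ) + 1 < P := by
    have := (ENNReal.toReal_lt_toReal (by simp) hp'top).2 hp'1
    rwa [ENNReal.toReal_natCast, Nat.cast_add_one] at this
  have : IsFiniteMeasure (μ.restrict (ball a R)) :=
    isFiniteMeasure_restrict.2 measure_ball_lt_top.ne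
  have hG' : MemLp G (ENNReal.ofReal P) (μ.restrict (ball a R)) :=
    hG.mono_exponent (by rw [hPp]; exact hp'2.le)
  have hn0 : (0 : ℝ) ≤ n := n.cast_nonneg
  have hP1 : 1 < P := by linarith
  have hc : P.HolderConjugate P.conjExponent := .conjExponent hP1
  -- The left side is `n / (P - 1)`, so this is exactly `P > n + 1`.
  have hq : n * (P.conjExponent - 1) < 1 := by
    have : P.conjExponent - 1 = 1 / (P - 1) := by
      rw [Real.conjExponent]
      field_simp [(by linarith : P - 1 ≠ 0)]
      ring
    rw [this, mul_one_div, div_lt_one (by linarith)]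
    linarith
  -- With this radius the ball about `y` contains `ball a R`.
  have hk0 := memLp_norm_pow_inv_ball (μ := μ) hn hc.symm.pos hq (R + dist a y)
  have hmp : MeasurePreserving (fun x : E => x - y) (μ.restrict (ball y (R + dist a y)))
      (μ.restrict (ball 0 (R + dist a y))) := by
    have := (measurePreserving_sub_right μ y).restrict_preimage
      (measurableSet_ball (x := (0 : E)) (ε := R + dist a y))
    convert this using 2
    ext x
    simp [dist_eq_norm]
  have hk : MemLp (fun x : E => (‖x - y‖ ^ n)⁻¹) (ENNReal.ofReal P.conjExponent)
      (μ.restrict (ball a R)) :=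
    (hk0.comp_measurePreserving hmp).mono_measure
      (Measure.restrict_mono (ball_subset_ball' le_rfl) le_rfl)
  have := hc.ennrealOfReal
  exact hG'.norm.integrable_mul hk

theorem integrableOn_inner_div_norm_pow {p : ℝ≥0∞} (hp : (Module.finrank ℝ E : ℝ≥0∞) < p)
    {G : E → E} {a : E} {R : ℝ} (hG : MemLp G p (μ.restrict (ball a R))) (y : E) :
    IntegrableOn (fun x => inner ℝ (G x) (x - y) / ‖x - y‖ ^ Module.finrank ℝ E)
      (ball a R) μ := by
  obtain ⟨n, hn⟩ := Nat.exists_eq_succ_of_ne_zero (Module.finrank_pos (R := ℝ) (M := E)).ne'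
  rw [hn] at hp ⊢
  refine (integrableOn_norm_mul_norm_sub_pow_inv hn hp hG y).mono' ?_ (.of_forall fun x => ?_)
  · have h1 : AEStronglyMeasurable (fun x : E => x - y) (μ.restrict (ball a R)) := by fun_prop
    exact ((hG.1.inner h1).aemeasurable.div
      (by fun_prop)).aestronglyMeasurable
  · rcases eq_or_ne x y with rfl | hxy
    · simp
      positivity
    have h0 : 0 < ‖x - y‖ := norm_pos_iff.2 (sub_ne_zero.2 hxy)
    rw [norm_div, norm_pow, norm_norm, div_le_iff₀ (by positivity), Nat.succ_eq_add_one,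
      pow_succ]
    refine (norm_inner_le_norm _ _).trans_eq ?_
    field_simp

end Kernel

/-! ### Means over spheres and balls -/

section SphereMeasure

variable {N : ℕ} {a : EuclideanSpace ℝ (Fin N)} {R : ℝ}

theorem measurableEmbedding_sphere (a : EuclideanSpace ℝ (Fin N)) (hR : R ≠ 0) :
    MeasurableEmbedding fun w : sphere (0 : EuclideanSpace ℝ (Fin N)) 1 =>
      a + R • (w : EuclideanSpace ℝ (Fin N)) :=
  (Continuous.isClosedEmbedding (by fun_prop) ((add_right_injective a).comp
    ((smul_right_injective _ hR).comp Subtype.val_injective))).measurableEmbedding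

theorem integrable_sphereMeasure {g : EuclideanSpace ℝ (Fin N) → ℝ} (hR : R ≠ 0)
    (hg : Continuous fun w : sphere (0 : EuclideanSpace ℝ (Fin N)) 1 =>
      g (a + R • (w : EuclideanSpace ℝ (Fin N)))) : Integrable g (sphereMeasure a R) :=
  Integrable.smul_measure (((measurableEmbedding_sphere a hR).integrable_map_iff).2
    (hg.integrable_of_hasCompactSupport (HasCompactSupport.of_compactSpace _))) ENNReal.ofReal_ne_top

theorem integral_sphereMeasure (a : EuclideanSpace ℝ (Fin N))
    (g : EuclideanSpace ℝ (Fin N) → ℝ) (hR : 0 < R) :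
    ∫ x, g x ∂(sphereMeasure a R) =
      R ^ (N - 1) * ∫ w : sphere (0 : EuclideanSpace ℝ (Fin N)) 1,
        g (a + R • (w : EuclideanSpace ℝ (Fin N)))
        ∂(volume : Measure (EuclideanSpace ℝ (Fin N))).toSphere := by
  rw [sphereMeasure, integral_smul_measure, (measurableEmbedding_sphere a hR.ne').integral_map,
    ENNReal.toReal_ofReal (by positivity), smul_eq_mul]

theorem sphereMeasure_real_univ (a : EuclideanSpace ℝ (Fin N)) (hR : 0 < R) :
    (sphereMeasure a R).real univ = R ^ (N - 1) * sphereArea N := by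
  have := integral_sphereMeasure a (fun _ => (1 : ℝ)) hR
  simpa [sphereArea] using this

theorem average_sphereMeasure (a : EuclideanSpace ℝ (Fin N))
    (g : EuclideanSpace ℝ (Fin N) → ℝ) (hR : 0 < R) :
    ⨍ x, g x ∂(sphereMeasure a R) = (∫ w : sphere (0 : EuclideanSpace ℝ (Fin N)) 1,
      g (a + R • (w : EuclideanSpace ℝ (Fin N)))
      ∂(volume : Measure (EuclideanSpace ℝ (Fin N))).toSphere) / sphereArea N := by
  rw [average_eq, sphereMeasure_real_univ a hR, integral_sphereMeasure a g hR, smul_eq_mul,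
    inv_mul_eq_div, mul_div_mul_left _ _ (by positivity)]

theorem sphereArea_pos (hN : N ≠ 0) : 0 < sphereArea N := by
  have hN' : (0 : ℝ) < N := by exact_mod_cast Nat.pos_of_ne_zero hN
  rw [sphereArea_eq hN]
  have := Real.Gamma_pos_of_pos (show (0 : ℝ) < N / 2 by positivity)
  positivity

theorem average_ball (hN : N ≠ 0) (a : EuclideanSpace ℝ (Fin N))
    (g : EuclideanSpace ℝ (Fin N) → ℝ) (hR : 0 < R) :
    ⨍ x in ball a R, g x = N * (∫ x in ball a R, g x) / (R ^ N * sphereArea N) := by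
  have hN' : (N : ℝ) ≠ 0 := by exact_mod_cast hN
  rw [setAverage_eq, measureReal_def, Measure.addHaar_ball_of_pos _ a hR, ENNReal.toReal_mul,
    ENNReal.toReal_ofReal (by positivity), sphereArea, Measure.toSphere_real_apply_univ,
    finrank_euclideanSpace_fin, smul_eq_mul, measureReal_def]
  field_simp

end SphereMeasure

/-! ### The two identities in Euclidean space -/

section Representation

variable {N : ℕ} {a y : EuclideanSpace ℝ (Fin N)} {R : ℝ} {f : EuclideanSpace ℝ (Fin N) → ℝ}
  {S : Set (EuclideanSpace ℝ (Fin N))}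

theorem average_ball_sub_average_sphere (hN : N ≠ 0) (hR : 0 < R) (hS : S.Countable)
    (hfc : ContinuousOn f (closedBall a R))
    (hfd : ∀ x ∈ ball a R \ S, DifferentiableAt ℝ f x)
    (hi : IntegrableOn (fun x => inner ℝ (gradient f x) (x - a)) (ball a R)) :
    (⨍ x in ball a R, f x) - (⨍ x, f x ∂(sphereMeasure a R)) =
      -(1 / sphereArea N * ∫ x in ball a R, inner ℝ (gradient f x) (x - a) / R ^ N) := by
  have : Nonempty (Fin N) := ⟨⟨0, Nat.pos_of_ne_zero hN⟩⟩
  have hA := sphereArea_pos hN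
  have hif : IntegrableOn f (ball a R) :=
    (hfc.integrableOn_compact (isCompact_closedBall a R)).mono_set ball_subset_closedBall
  have key := integral_inner_add_ball (μ := volume) hR hS hfc
    (fun x hx => (hfd x hx).hasGradientAt) (hi.add (hif.const_mul _))
  rw [integral_add hi (hif.const_mul _), integral_const_mul, finrank_euclideanSpace_fin] at key
  rw [average_ball hN a f hR, average_sphereMeasure a f hR, integral_div]
  field_simp
  linarith

theorem continuous_kernel_sphere (hN : N ≠ 0) (hR : 0 < R)
    (hfc : ContinuousOn f (closedBall a R)) (hy : y ∈ ball a R) :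
    Continuous fun w : sphere (0 : EuclideanSpace ℝ (Fin N)) 1 =>
      f (a + R • (w : EuclideanSpace ℝ (Fin N))) *
        inner ℝ (a + R • (w : EuclideanSpace ℝ (Fin N)) - y)
          (a + R • (w : EuclideanSpace ℝ (Fin N)) - a) /
        (R * sphereArea N * ‖a + R • (w : EuclideanSpace ℝ (Fin N)) - y‖ ^ N) := by
  have hA := sphereArea_pos hN
  refine ((continuous_comp_sphere hR.le hfc).mul (by fun_prop)).div (by fun_prop) fun w => ?_
  have h1 : a + R • (w : EuclideanSpace ℝ (Fin N)) - y ≠ 0 := by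
    intro h
    rw [← sub_eq_zero.1 h] at hy
    simp [dist_eq_norm, norm_smul, abs_of_pos hR] at hy
  have := norm_pos_iff.2 h1
  positivity

theorem representation_by_sphere_kernel (hN : N ≠ 0) (hR : 0 < R) (hS : S.Countable)
    (hfc : ContinuousOn f (closedBall a R))
    (hfd : ∀ x ∈ ball a R \ S, DifferentiableAt ℝ f x) (hy : y ∈ ball a R)
    (hi : IntegrableOn (fun x => inner ℝ (gradient f x) (x - y) / ‖x - y‖ ^ N) (ball a R)) :
    f y = (∫ x, f x * inner ℝ (x - y) (x - a) / (R * sphereArea N * ‖x - y‖ ^ N)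
        ∂(sphereMeasure a R)) -
      1 / sphereArea N * ∫ x in ball a R, inner ℝ (gradient f x) (x - y) / ‖x - y‖ ^ N := by
  have : Nonempty (Fin N) := ⟨⟨0, Nat.pos_of_ne_zero hN⟩⟩
  have hA := sphereArea_pos hN
  have hRe : R • (R⁻¹ • (a - y)) = a - y := smul_inv_smul₀ hR.ne' _
  have key := integral_inner_div_norm_pow_ball (μ := volume) hR hS hfc
    (fun x hx => (hfd x hx).hasGradientAt) hy
    (by rw [finrank_euclideanSpace_fin]; exact hi) hRe
  rw [finrank_euclideanSpace_fin, ← sphereArea] at key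
  -- At `x = a + R • w` one has `x - y = R • (w + e)` and `x - a = R • w`; all powers of `R`,
  -- including that of the surface measure, cancel.
  have hk : ∫ x, f x * inner ℝ (x - y) (x - a) / (R * sphereArea N * ‖x - y‖ ^ N)
      ∂(sphereMeasure a R) = 1 / sphereArea N *
      ∫ w : sphere (0 : EuclideanSpace ℝ (Fin N)) 1, f (a + R • (w : EuclideanSpace ℝ (Fin N))) *
        ((1 + inner ℝ (w : EuclideanSpace ℝ (Fin N)) (R⁻¹ • (a - y))) /
          ‖(w : EuclideanSpace ℝ (Fin N)) + R⁻¹ • (a - y)‖ ^ N)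
        ∂(volume : Measure (EuclideanSpace ℝ (Fin N))).toSphere := by
    rw [integral_sphereMeasure a _ hR, ← integral_const_mul, ← integral_const_mul]
    refine integral_congr_ae (.of_forall fun w => ?_)
    dsimp only
    have hw : inner ℝ (w : EuclideanSpace ℝ (Fin N)) (w : EuclideanSpace ℝ (Fin N)) = (1 : ℝ) := by
      rw [real_inner_self_eq_norm_sq]; simp
    have hx : a + R • (w : EuclideanSpace ℝ (Fin N)) - y =
        R • ((w : EuclideanSpace ℝ (Fin N)) + R⁻¹ • (a - y)) := by
      rw [smul_add, hRe]; abel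
    have hpow : R ^ N = R ^ (N - 1) * R := by
      rw [← pow_succ, Nat.sub_add_cancel (Nat.one_le_iff_ne_zero.2 hN)]
    rw [hx, add_sub_cancel_left, real_inner_smul_left, real_inner_smul_right, inner_add_left, hw,
      real_inner_comm, norm_smul, Real.norm_of_nonneg hR.le, mul_pow, hpow]
    field_simp
  rw [hk, key]
  field_simp
  ring

end Representation

/-! ### The representation formulas -/

theorem corollary4 {N : ℕ} (hN : 2 ≤ N)
    (Ω : Set (EuclideanSpace ℝ (Fin N))) (hΩ : IsOpen Ω) (hΩb : Bornology.IsBounded Ω)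
    (A : Finset (EuclideanSpace ℝ (Fin N))) (hA : (A : Set (EuclideanSpace ℝ (Fin N))) ⊆ Ω)
    (f : EuclideanSpace ℝ (Fin N) → ℝ)
    (hfc : ContinuousOn f (closure Ω)) (hfd : ContDiffOn ℝ 1 f (Ω \ A))
    (α : ℝ) (hα : α ∈ Ioo (0 : ℝ) 1)
    (hH : ∀ c ∈ A,
      limsup (fun x => ((|f x - f c| / ‖x - c‖ ^ α : ℝ) : EReal)) (𝓝[≠] c) < ⊤)
    (p : ℝ≥0∞) (hp : (N : ℝ≥0∞) < p) (hfW : MemSobolevOne p Ω f)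
    (a : EuclideanSpace ℝ (Fin N)) (R : ℝ) (hR : 0 < R) (hB : ball a R ⊆ Ω) :
    -- the integrals of `f` over the ball and over the sphere converge
    IntegrableOn f (ball a R) ∧ Integrable f (sphereMeasure a R) ∧
    -- the representation at an arbitrary point of the ball
    (∀ y ∈ ball a R,
      Integrable (fun x => f x * inner ℝ (x - y) (x - a) / (R * sphereArea N * ‖x - y‖ ^ N))
        (sphereMeasure a R) ∧
      IntegrableOn (fun x => inner ℝ (gradient f x) (x - y) / ‖x - y‖ ^ N
        - inner ℝ (gradient f x) (x - a) / R ^ N) (ball a R) ∧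
      f y = (⨍ x in ball a R, f x) - (⨍ x, f x ∂(sphereMeasure a R))
        + (∫ x, f x * inner ℝ (x - y) (x - a) / (R * sphereArea N * ‖x - y‖ ^ N)
            ∂(sphereMeasure a R))
        - 1 / sphereArea N *
          ∫ x in ball a R, (inner ℝ (gradient f x) (x - y) / ‖x - y‖ ^ N
            - inner ℝ (gradient f x) (x - a) / R ^ N)) ∧
    -- the value at the centre through the mean over the ball
    (IntegrableOn (fun x => (1 / ‖x - a‖ ^ N - 1 / R ^ N) * inner ℝ (gradient f x) (x - a))
        (ball a R) ∧
      f a = (⨍ x in ball a R, f x)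
        - 1 / sphereArea N *
          ∫ x in ball a R, (1 / ‖x - a‖ ^ N - 1 / R ^ N) * inner ℝ (gradient f x) (x - a)) ∧
    -- the value at the centre through the mean over the sphere
    (IntegrableOn (fun x => inner ℝ (gradient f x) (x - a) / ‖x - a‖ ^ N) (ball a R) ∧
      f a = (⨍ x, f x ∂(sphereMeasure a R))
        - 1 / sphereArea N *
          ∫ x in ball a R, inner ℝ (gradient f x) (x - a) / ‖x - a‖ ^ N) := by

  have hN0 : N ≠ 0 := by omega
  have : Nonempty (Fin N) := ⟨⟨0, by omega⟩⟩
  have hp1 : 1 ≤ p := le_trans (by exact_mod_cast (by omega : 1 ≤ N)) hp.le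
  -- The sphere may touch the boundary of `Ω`, so continuity up to `closure Ω` is what counts.
  have hfcB : ContinuousOn f (closedBall a R) :=
    hfc.mono (by rw [← closure_ball a hR.ne']; exact closure_mono hB)
  have hU : IsOpen (Ω \ A) := hΩ.sdiff A.finite_toSet.isClosed
  have hfdB : ∀ x ∈ ball a R \ A, DifferentiableAt ℝ f x := fun x hx =>
    (hfd.differentiableOn one_ne_zero).differentiableAt (hU.mem_nhds ⟨hB hx.1, hx.2⟩)
  have hS : (A : Set (EuclideanSpace ℝ (Fin N))).Countable := A.countable_toSet
  have hG : MemLp (gradient f) p (volume.restrict (ball a R)) :=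
    (hfW.memLp_gradient hΩ (by omega) hfd hp1).mono_measure (Measure.restrict_mono hB le_rfl)
  have hiB : IntegrableOn f (ball a R) :=
    (hfcB.integrableOn_compact (isCompact_closedBall a R)).mono_set ball_subset_closedBall
  have hiG := integrableOn_inner_sub hp1 hG
  have hiK : ∀ y, IntegrableOn (fun x => inner ℝ (gradient f x) (x - y) / ‖x - y‖ ^ N)
      (ball a R) := fun y => by
    have := integrableOn_inner_div_norm_pow (by rwa [finrank_euclideanSpace_fin]) hG y
    rwa [finrank_euclideanSpace_fin] at this
  have hI := average_ball_sub_average_sphere hN0 hR hS hfcB hfdB hiG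
  have hII := fun y hy => representation_by_sphere_kernel hN0 hR hS hfcB hfdB (y := y) hy (hiK y)
  have hA := sphereArea_pos hN0
  have ha := mem_ball_self (x := a) hR
  -- For `y = a` the boundary kernel is the constant `1 / (ω_N R ^ (N - 1))`, so its integral is the
  -- sphere mean.
  have hIII : f a = (⨍ x, f x ∂(sphereMeasure a R)) - 1 / sphereArea N *
      ∫ x in ball a R, inner ℝ (gradient f x) (x - a) / ‖x - a‖ ^ N := by
    conv_lhs => rw [hII a ha]
    congr 1
    rw [integral_sphereMeasure a _ hR, average_sphereMeasure a f hR, div_eq_inv_mul,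
      ← integral_const_mul, ← integral_const_mul]
    refine integral_congr_ae (.of_forall fun w => ?_)
    have hpow : R ^ N = R ^ (N - 1) * R := by
      rw [← pow_succ, Nat.sub_add_cancel (by omega)]
    simp only [add_sub_cancel_left, real_inner_self_eq_norm_sq, norm_smul,
      Real.norm_of_nonneg hR.le, norm_eq_of_mem_sphere, mul_one, hpow]
    field_simp
  have hker : ∀ x, (1 / ‖x - a‖ ^ N - 1 / R ^ N) * inner ℝ (gradient f x) (x - a) =
      inner ℝ (gradient f x) (x - a) / ‖x - a‖ ^ N - inner ℝ (gradient f x) (x - a) / R ^ N :=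
    fun x => by ring
  refine ⟨hiB, integrable_sphereMeasure hR.ne' (continuous_comp_sphere hR.le hfcB),
    fun y hy => ⟨integrable_sphereMeasure hR.ne' (continuous_kernel_sphere hN0 hR hfcB hy),
      (hiK y).sub (hiG.div_const _), ?_⟩, ⟨?_, ?_⟩, hiK a, hIII⟩
  -- The difference of means cancels the `R ^ N` part of the volume integral, leaving the
  -- sphere-kernel representation.
  · rw [integral_sub (hiK y) (hiG.div_const _), hI]
    conv_lhs => rw [hII y hy]
    ring
  · simp_rw [hker]
    exact (hiK a).sub (hiG.div_const _)
  · simp_rw [hker]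
    rw [integral_sub (hiK a) (hiG.div_const _), mul_sub]
    linarith
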